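/- A finite set $S$ of points in the plane is in general position if no three of its points lie on a line, and it is $c$-colored if it is partitioned into $c$ non-empty color classes. For integers $c \ge 1$ and $s \ge 0$ let $M_3(c,s)$ be the least integer $N$ such that every $c$-colored set $S$ of at least $N$ points in the plane in general position contains a triangle whose three vertices are points of $S$ of the same color and whose interior contains at most $s$ points of $S$ (of any color); put $M_3(c,s)=\infty$ if no such $N$ exists. **Theorem 2.** For every integer $c \ge 2$, the least integer $\lambda_3(c)\ge 0$ such that $M_3(c,\lambda_3(c))<\infty$ exists and satisfies $$\left\lfloor \frac{c-1}{2}\right\rfloor \le \lambda_3(c) \le c-2.$$ -/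

import Mathlib

/-- The Euclidean plane. -/
abbrev Plane : Type := EuclideanSpace ℝ (Fin 2)

/-- A finite planar point set is in general position if no three of its points are on a line. -/
def GeneralPosition (S : Finset Plane) : Prop :=
  ∀ p ∈ S, ∀ q ∈ S, ∀ r ∈ S, p ≠ q → p ≠ r → q ≠ r → ¬ Collinear ℝ ({p, q, r} : Set Plane)

/-- `col` is a `c`-coloring of `S`: it partitions `S` into `c` color classes, all non-empty.
(The values of `col` outside `S` are irrelevant.) -/
def IsColoring {c : ℕ} (S : Finset Plane) (col : Plane → Fin c) : Prop :=
  ∀ i : Fin c, ∃ p ∈ S, col p = i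

/-- A set of points is monochromatic if all its points have the same color. -/
def Monochromatic {c : ℕ} (col : Plane → Fin c) (T : Finset Plane) : Prop :=
  ∃ i : Fin c, ∀ p ∈ T, col p = i

/-- The number of points of `S` in the interior of the convex hull of `T`. -/
noncomputable def interiorCount (S T : Finset Plane) : ℕ :=
  ((S : Set Plane) ∩ interior (convexHull ℝ (T : Set Plane))).ncard

/-- The `c`-colored set `S` contains a monochromatic convex polygon with `r` vertices and
with at most `s` interior points. -/
def HasMonoPolygon {c : ℕ} (S : Finset Plane) (col : Plane → Fin c) (r s : ℕ) : Prop :=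
  ∃ T : Finset Plane, T ⊆ S ∧ T.card = r ∧
    ConvexIndependent ℝ (Subtype.val : ↥(T : Set Plane) → Plane) ∧
    Monochromatic col T ∧ interiorCount S T ≤ s

/-- Every `c`-colored set of at least `N` points in the plane in general position contains a
monochromatic convex polygon with `r` vertices and with at most `s` interior points. -/
def Forces (r c s N : ℕ) : Prop :=
  ∀ S : Finset Plane, GeneralPosition S → N ≤ S.card →
    ∀ col : Plane → Fin c, IsColoring S col → HasMonoPolygon S col r s

/-- `M r c s` is the least `N` with `Forces r c s N`, and `∞` if there is none. -/
noncomputable def M (r c s : ℕ) : ℕ∞ :=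
  sInf {n : ℕ∞ | ∃ N : ℕ, n = (N : ℕ∞) ∧ Forces r c s N}

/-- `lambda3 c` is the least `s` with `M 3 c s < ∞`. -/
noncomputable def lambda3 (c : ℕ) : ℕ :=
  sInf {s : ℕ | M 3 c s < ⊤}

/-! Upper bound. Let c = e + 2 and suppose that every monochromatic triangle contains at least e + 1
points. Order a largest color class, of m points, by angle around an extreme point p. The m - 2
triangles between p and consecutive points are interior disjoint and contain only points of the
other e + 1 colors, of which there are at most (e + 1)m. This count falls just short of a
contradiction: three more disjoint triangles suffice. They come from reflex vertices of the chain of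
the remaining points, since the triangle at such a vertex lies outside the fan.

Reflex vertices are frequent. A convex stretch of the chain spans, with p, a convex polygon whose
interior misses the color of p. There the same fan count has only e colors available for e + 1
points per triangle, so the interior has boundedly many points and the stretch is short
(`card_le_of_missing_color`, `convex_chain_length_le`, `card_lt_of_trianglesContain`).

Lower bound. Color a Horton set by index modulo the largest odd c' ≤ c. The even and odd indices
form two far-apart layers, each an affine copy of a smaller Horton set, and halving indices
preserves congruence modulo c'. A monochromatic triangle thus descends to one with vertices in both
layers. Two of its vertices share a layer, and the points of that layer on the side of their line
facing the third vertex, between the two, lie inside; there are at least (c' - 1)/2 of them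
(`exists_between_hortonPoint`, `exists_inTri_hortonPoint`). -/

/-! ### Orientations and interiors of triangles -/

/-- Twice the signed area of the triangle `a b c`. -/
def orient (a b c : Plane) : ℝ :=
  (b 0 - a 0) * (c 1 - a 1) - (c 0 - a 0) * (b 1 - a 1)

/-- `x` lies strictly inside the positively oriented triangle `a b d`. -/
def InTri (a b d x : Plane) : Prop :=
  0 < orient a b x ∧ 0 < orient b d x ∧ 0 < orient d a x

theorem orient_rotate (a b c : Plane) : orient b c a = orient a b c := by
  unfold orient; ring

theorem orient_swap (a b c : Plane) : orient b a c = -orient a b c := by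
  unfold orient; ring

theorem orient_swap_right (a b c : Plane) : orient a c b = -orient a b c := by
  unfold orient; ring

@[simp] theorem orient_self_left (a b : Plane) : orient a a b = 0 := by
  unfold orient; ring

@[simp] theorem orient_self_right (a b : Plane) : orient a b b = 0 := by
  unfold orient; ring

@[simp] theorem orient_self_outer (a b : Plane) : orient a b a = 0 := by
  unfold orient; ring

theorem orient_smul_add (u v a b d : Plane) (r s t : ℝ) (h : r + s + t = 1) :
    orient u v (r • a + s • b + t • d) =
      r * orient u v a + s * orient u v b + t * orient u v d := by
  obtain rfl : t = 1 - r - s := by linarith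
  simp only [orient, PiLp.add_apply, PiLp.smul_apply, smul_eq_mul]
  ring

theorem continuous_orient (a b : Plane) : Continuous (orient a b) := by
  unfold orient; fun_prop

/-- The ratios of the subtriangle areas to the area of `a b d` are the barycentric coordinates of
`x`, and `orient u v` is affine. -/
theorem orient_cramer (a b d u v x : Plane) :
    orient a b d * orient u v x =
      orient b d x * orient u v a + orient d a x * orient u v b + orient a b x * orient u v d := by
  unfold orient; ring

theorem orient_add_orient (a b d x : Plane) :
    orient b d x + orient d a x + orient a b x = orient a b d := by
  unfold orient; ring

theorem InTri.orient_pos {a b d x : Plane} (h : InTri a b d x) : 0 < orient a b d := by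
  rw [← orient_add_orient a b d x]
  linarith [h.1, h.2.1, h.2.2]

/-- An interior point has three positive barycentric weights, so a single vertex strictly inside the
half-plane is enough. -/
theorem InTri.pos_of_nonneg {a b d x u v : Plane} (h : InTri a b d x) (ha : 0 ≤ orient u v a)
    (hb : 0 ≤ orient u v b) (hd : 0 ≤ orient u v d)
    (hs : 0 < orient u v a ∨ 0 < orient u v b ∨ 0 < orient u v d) : 0 < orient u v x := by
  have h1 := orient_cramer a b d u v x
  have ⟨h2, h3, h4⟩ := h
  refine pos_of_mul_pos_right (a := orient a b d) ?_ h.orient_pos.le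
  rw [h1]
  rcases hs with hs | hs | hs <;> positivity

theorem collinear_iff_orient {p q r : Plane} (hpq : p ≠ q) :
    Collinear ℝ ({p, q, r} : Set Plane) ↔ orient p q r = 0 := by
  constructor
  · intro h
    rw [collinear_iff_of_mem (p₀ := p) (by simp)] at h
    obtain ⟨v, hv⟩ := h
    obtain ⟨s, rfl⟩ := hv q (by simp)
    obtain ⟨t, rfl⟩ := hv r (by simp)
    simp [orient]
    ring
  · intro h
    rw [collinear_iff_of_mem (p₀ := p) (by simp)]
    refine ⟨q - p, ?_⟩
    have hne : q 0 - p 0 ≠ 0 ∨ q 1 - p 1 ≠ 0 := by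
      by_contra! hc
      apply hpq
      ext i
      fin_cases i
      · simpa using (sub_eq_zero.1 hc.1).symm
      · simpa using (sub_eq_zero.1 hc.2).symm
    have hr : ∃ t : ℝ, r = t • (q - p) +ᵥ p := by
      unfold orient at h
      rcases hne with hne | hne
      · refine ⟨(r 0 - p 0) / (q 0 - p 0), ?_⟩
        ext i
        fin_cases i
        · simp; field_simp; ring
        · simp; field_simp; linarith
      · refine ⟨(r 1 - p 1) / (q 1 - p 1), ?_⟩
        ext i
        fin_cases i
        · simp; field_simp; linarith
        · simp; field_simp; ring
    rintro x (rfl | rfl | rfl)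
    · exact ⟨0, by simp⟩
    · exact ⟨1, by simp⟩
    · exact hr

theorem notMem_convexHull_of_orient_ne_zero {u v x : Plane} (h : orient u v x ≠ 0)
    {s : Set Plane} (hs : s ⊆ {u, v}) : x ∉ convexHull ℝ s := by
  intro hx
  have h1 := convexHull_mono hs hx
  rw [convexHull_pair] at h1
  obtain ⟨r, t, -, -, hrt, rfl⟩ := h1
  apply h
  have := orient_smul_add u v u v v r t 0 (by linarith)
  simpa using this

theorem convexIndependent_of_orient_ne_zero {a b d : Plane} (h : orient a b d ≠ 0) :
    ConvexIndependent ℝ (Subtype.val : ↥({a, b, d} : Set Plane) → Plane) := by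
  rw [convexIndependent_set_iff_notMem_convexHull_sdiff]
  have h1 : orient b d a ≠ 0 := by rwa [orient_rotate]
  have h2 : orient d a b ≠ 0 := by rwa [orient_rotate, orient_rotate]
  rintro x (rfl | rfl | rfl)
  · refine notMem_convexHull_of_orient_ne_zero h1 ?_
    rintro y ⟨rfl | rfl | rfl, hy⟩ <;> simp_all
  · refine notMem_convexHull_of_orient_ne_zero h2 ?_
    rintro y ⟨rfl | rfl | rfl, hy⟩ <;> simp_all
  · refine notMem_convexHull_of_orient_ne_zero h ?_
    rintro y ⟨rfl | rfl | rfl, hy⟩ <;> simp_all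

theorem mem_convexHull_triple {a b d x : Plane} :
    x ∈ convexHull ℝ ({a, b, d} : Set Plane) ↔
      ∃ r s t : ℝ, 0 ≤ r ∧ 0 ≤ s ∧ 0 ≤ t ∧ r + s + t = 1 ∧ r • a + s • b + t • d = x := by
  rw [convexHull_insert (by simp), convexHull_pair, mem_convexJoin]
  constructor
  · rintro ⟨_, rfl, y, ⟨s, t, hs, ht, hst, rfl⟩, ⟨u, v, hu, hv, huv, rfl⟩⟩
    refine ⟨u, v * s, v * t, hu, by positivity, by positivity, ?_, ?_⟩
    · rw [add_assoc, ← mul_add, hst]; linarith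
    · simp [smul_add, smul_smul, add_assoc]
  · rintro ⟨r, s, t, hr, hs, ht, h, rfl⟩
    refine ⟨a, rfl, ?_⟩
    rcases eq_or_lt_of_le (add_nonneg hs ht) with h0 | h0
    · have hs0 : s = 0 := by linarith
      have ht0 : t = 0 := by linarith
      refine ⟨b, left_mem_segment ℝ b d, 1, 0, by simp, by simp, by simp, ?_⟩
      have : r = 1 := by linarith
      simp [hs0, ht0, this]
    · refine ⟨(s / (s + t)) • b + (t / (s + t)) • d,
        ⟨s / (s + t), t / (s + t), by positivity, by positivity, by field_simp, rfl⟩,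
        r, s + t, hr, h0.le, by linarith, ?_⟩
      rw [smul_add, smul_smul, smul_smul, add_assoc]
      congr 3 <;> field_simp

theorem interior_convexHull_triple {a b d : Plane} (h : 0 < orient a b d) :
    interior (convexHull ℝ ({a, b, d} : Set Plane)) = {x | InTri a b d x} := by
  apply Set.Subset.antisymm
  · have key : ∀ u v w : Plane, 0 < orient u v w →
        convexHull ℝ ({a, b, d} : Set Plane) ⊆ {x | 0 ≤ orient u v x} →
        ∀ x ∈ interior (convexHull ℝ ({a, b, d} : Set Plane)), 0 < orient u v x := by
      intro u v w hw hsub x hx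
      refine lt_of_le_of_ne (hsub (interior_subset hx)) fun h0 => ?_
      -- If an interior point `x` were on the side line, moving it slightly away from the opposite
      -- vertex `w` would stay in the hull yet cross that line.
      have hc : Filter.Tendsto (fun t : ℝ => x + t • (x - w)) (nhdsWithin 0 (Set.Ioi 0))
          (nhds x) := by
        have : Continuous (fun t : ℝ => x + t • (x - w)) := by fun_prop
        have h2 := this.tendsto 0
        simp only [zero_smul, add_zero] at h2
        exact h2.mono_left nhdsWithin_le_nhds
      have hev := hc.eventually (isOpen_interior.mem_nhds hx)
      obtain ⟨t, ht, htpos⟩ := (hev.and self_mem_nhdsWithin).exists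
      have h1 : 0 ≤ orient u v (x + t • (x - w)) := hsub (interior_subset ht)
      have h2 : orient u v (x + t • (x - w)) = (1 + t) * orient u v x - t * orient u v w := by
        simp [orient]; ring
      rw [h2, ← h0] at h1
      have : 0 < t * orient u v w := mul_pos htpos hw
      linarith
    have sub : ∀ u v : Plane, 0 ≤ orient u v a → 0 ≤ orient u v b → 0 ≤ orient u v d →
        convexHull ℝ ({a, b, d} : Set Plane) ⊆ {x | 0 ≤ orient u v x} := by
      intro u v h1 h2 h3 x hx
      obtain ⟨r, s, t, hr, hs, ht, hsum, rfl⟩ := mem_convexHull_triple.1 hx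
      simp only [Set.mem_ofPred_eq]
      rw [orient_smul_add _ _ _ _ _ _ _ _ hsum]
      positivity
    have h' : 0 < orient b d a := by rwa [orient_rotate]
    have h'' : 0 < orient d a b := by rwa [orient_rotate, orient_rotate]
    intro x hx
    exact ⟨key a b d h (sub a b (by simp) (by simp) h.le) x hx,
      key b d a h' (sub b d h'.le (by simp) (by simp)) x hx,
      key d a b h'' (sub d a (by simp) h''.le (by simp)) x hx⟩
  · apply interior_maximal
    · rintro x ⟨h1, h2, h3⟩
      rw [mem_convexHull_triple]
      refine ⟨orient b d x / orient a b d, orient d a x / orient a b d,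
        orient a b x / orient a b d, by positivity, by positivity, by positivity, ?_, ?_⟩
      · rw [← add_div, ← add_div, orient_add_orient, div_self h.ne']
      · have hne := h.ne'
        ext i
        simp only [PiLp.add_apply, PiLp.smul_apply, smul_eq_mul]
        field_simp
        fin_cases i <;> simp [orient] <;> ring
    · exact ((isOpen_lt continuous_const (continuous_orient a b)).inter
        ((isOpen_lt continuous_const (continuous_orient b d)).inter
          (isOpen_lt continuous_const (continuous_orient d a))))

open Classical in
theorem interiorCount_triple (S : Finset Plane) {a b d : Plane} (h : 0 < orient a b d) :
    interiorCount S {a, b, d} = (S.filter (InTri a b d)).card := by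
  have : ((S : Set Plane) ∩ interior (convexHull ℝ (({a, b, d} : Finset Plane) : Set Plane)))
      = ((S.filter (InTri a b d) : Finset Plane) : Set Plane) := by
    ext x
    simp [interior_convexHull_triple h]
  rw [interiorCount, this, Set.ncard_coe_finset]

/-! ### Angular order around an extreme point -/

/-- A finite set in general position is a fan: it can be enumerated as an apex `p` followed by
points `q 0, q 1, …` in angular order around `p`. -/
theorem exists_fan {P : Finset Plane} (hP : GeneralPosition P) {n : ℕ} (hn : P.card = n + 1) :
    ∃ p ∈ P, ∃ q : ℕ → Plane, (∀ i < n, q i ∈ P) ∧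
      (∀ i j, i < j → j < n → 0 < orient p (q i) (q j)) ∧
      ∀ x ∈ P, x = p ∨ ∃ i < n, x = q i := by
  classical
  obtain ⟨p, hp, hmax⟩ := P.exists_max_image (fun x => x 0 ^ 2 + x 1 ^ 2)
    (Finset.card_pos.1 (by omega))
  -- The point `p` is farthest from the origin, so the inner product `f x` of `p` with `p - x` is
  -- positive for every other point. Then `g` is the tangent of the angle of `x - p` measured from
  -- `-p`, and sorting by `g` sorts by angle.
  set f : Plane → ℝ := fun x => p 0 * (p 0 - x 0) + p 1 * (p 1 - x 1) with hf
  set g : Plane → ℝ := fun x => (p 1 * (x 0 - p 0) - p 0 * (x 1 - p 1)) / f x with hg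
  have fpos : ∀ x ∈ P.erase p, 0 < f x := by
    intro x hx
    obtain ⟨hne, hxP⟩ := Finset.mem_erase.1 hx
    have h1 := hmax x hxP
    have h2 : x 0 - p 0 ≠ 0 ∨ x 1 - p 1 ≠ 0 := by
      by_contra! hc
      apply hne
      ext i
      fin_cases i
      · simpa using sub_eq_zero.1 hc.1
      · simpa using sub_eq_zero.1 hc.2
    have h3 : 0 < (x 0 - p 0) ^ 2 + (x 1 - p 1) ^ 2 := by
      rcases h2 with h2 | h2 <;> positivity
    simp only [hf]
    nlinarith
  have hpp : ∀ x ∈ P.erase p, 0 < p 0 ^ 2 + p 1 ^ 2 := by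
    intro x hx
    have h1 := fpos x hx
    by_contra hc
    have h0 : p 0 = 0 := by nlinarith [sq_nonneg (p 0), sq_nonneg (p 1)]
    have h0' : p 1 = 0 := by nlinarith [sq_nonneg (p 0), sq_nonneg (p 1)]
    simp [hf, h0, h0'] at h1
  have horient : ∀ x ∈ P.erase p, ∀ y ∈ P.erase p,
      (p 0 ^ 2 + p 1 ^ 2) * orient p x y = f x * f y * (g y - g x) := by
    intro x hx y hy
    have h1 := (fpos x hx).ne'
    have h2 := (fpos y hy).ne'
    have : f x * f y * (g y - g x) = f x * (p 1 * (y 0 - p 0) - p 0 * (y 1 - p 1))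
        - f y * (p 1 * (x 0 - p 0) - p 0 * (x 1 - p 1)) := by
      simp only [hg]; field_simp
    rw [this]
    simp only [hf, orient]
    ring
  have ginj : Set.InjOn g (P.erase p : Finset Plane) := by
    intro x hx y hy hxy
    by_contra hne
    have h1 := horient x hx y hy
    rw [hxy, sub_self, mul_zero] at h1
    have h2 : orient p x y = 0 := by
      rcases mul_eq_zero.1 h1 with h | h
      · exact absurd h (hpp x hx).ne'
      · exact h
    have hx' := Finset.mem_erase.1 (Finset.mem_coe.1 hx)
    have hy' := Finset.mem_erase.1 (Finset.mem_coe.1 hy)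
    exact hP p hp x hx'.2 y hy'.2 hx'.1.symm hy'.1.symm hne
      ((collinear_iff_orient hx'.1.symm).2 h2)
  have hcard : ((P.erase p).image g).card = n := by
    rw [Finset.card_image_of_injOn ginj, Finset.card_erase_of_mem hp, hn]; rfl
  set e := ((P.erase p).image g).orderEmbOfFin hcard with he
  have hmem : ∀ i : Fin n, ∃ x ∈ P.erase p, g x = e i := fun i =>
    Finset.mem_image.1 (Finset.orderEmbOfFin_mem _ hcard i)
  choose r hr hgr using hmem
  refine ⟨p, hp, fun i => if h : i < n then r ⟨i, h⟩ else p, ?_, ?_, ?_⟩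
  · intro i hi
    simp only [hi, dif_pos]
    exact Finset.mem_of_mem_erase (hr _)
  · intro i j hij hj
    have hi : i < n := hij.trans hj
    simp only [hi, hj, dif_pos]
    have h1 := horient _ (hr ⟨i, hi⟩) _ (hr ⟨j, hj⟩)
    have h2 : g (r ⟨i, hi⟩) < g (r ⟨j, hj⟩) := by
      rw [hgr, hgr]
      exact e.strictMono hij
    have h3 := fpos _ (hr ⟨i, hi⟩)
    have h4 := fpos _ (hr ⟨j, hj⟩)
    refine pos_of_mul_pos_right (a := p 0 ^ 2 + p 1 ^ 2) ?_ (hpp _ (hr ⟨i, hi⟩)).le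
    rw [h1]
    exact mul_pos (mul_pos h3 h4) (sub_pos.2 h2)
  · intro x hx
    by_cases hxp : x = p
    · exact Or.inl hxp
    right
    have hx' : x ∈ P.erase p := Finset.mem_erase.2 ⟨hxp, hx⟩
    have h1 : g x ∈ Set.range e := by
      rw [he, Finset.range_orderEmbOfFin]
      exact Finset.mem_coe.2 (Finset.mem_image_of_mem g hx')
    obtain ⟨i, hi⟩ := h1
    refine ⟨i, i.2, ?_⟩
    simp only [i.2, dif_pos, Fin.eta]
    exact ginj hx' (hr i) (by rw [hgr, hi])

/-! ### Horton sets and their two layers -/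

/-- The height of the `i`-th point of a Horton set, with scaling parameter `δ`. -/
noncomputable def hortonHeight (δ : ℝ) (i : ℕ) : ℝ :=
  if i = 0 then 0 else (i % 2 : ℕ) + δ * hortonHeight δ (i / 2)
  termination_by i
  decreasing_by omega

theorem hortonHeight_even (δ : ℝ) (i : ℕ) : hortonHeight δ (2 * i) = δ * hortonHeight δ i := by
  rcases Nat.eq_zero_or_pos i with rfl | hi
  · simp [hortonHeight]
  · rw [hortonHeight, if_neg (by omega)]
    simp

theorem hortonHeight_odd (δ : ℝ) (i : ℕ) :
    hortonHeight δ (2 * i + 1) = 1 + δ * hortonHeight δ i := by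
  rw [hortonHeight, if_neg (by omega)]
  have h1 : (2 * i + 1) % 2 = 1 := by omega
  have h2 : (2 * i + 1) / 2 = i := by omega
  rw [h1, h2]; simp

theorem hortonHeight_mem {δ : ℝ} (h0 : 0 ≤ δ) (h1 : δ ≤ 1 / 2) (i : ℕ) :
    0 ≤ hortonHeight δ i ∧ hortonHeight δ i ≤ 2 := by
  induction i using Nat.strong_induction_on with
  | _ i ih =>
    obtain ⟨k, rfl | rfl⟩ := Nat.even_or_odd' i
    · rcases Nat.eq_zero_or_pos k with rfl | hk
      · simp [hortonHeight]
      · obtain ⟨h2, h3⟩ := ih k (by omega)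
        rw [hortonHeight_even]
        exact ⟨by positivity, by nlinarith⟩
    · obtain ⟨h2, h3⟩ := ih k (by omega)
      rw [hortonHeight_odd]
      exact ⟨by positivity, by nlinarith⟩

/-- The `i`-th point of a Horton set. -/
noncomputable def hortonPoint (δ : ℝ) (i : ℕ) : Plane := !₂[(i : ℝ), hortonHeight δ i]

theorem orient_hortonPoint (δ : ℝ) (i j k : ℕ) :
    orient (hortonPoint δ i) (hortonPoint δ j) (hortonPoint δ k) =
      ((j : ℝ) - i) * (hortonHeight δ k - hortonHeight δ i) -
        ((k : ℝ) - i) * (hortonHeight δ j - hortonHeight δ i) := by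
  simp [orient, hortonPoint]

theorem hortonPoint_injective (δ : ℝ) : Function.Injective (hortonPoint δ) := by
  intro i j h
  have := congrArg (fun p : Plane => p 0) h
  simpa [hortonPoint] using this

theorem orient_hortonPoint_even (δ : ℝ) (i j k : ℕ) :
    orient (hortonPoint δ (2 * i)) (hortonPoint δ (2 * j)) (hortonPoint δ (2 * k)) =
      2 * δ * orient (hortonPoint δ i) (hortonPoint δ j) (hortonPoint δ k) := by
  simp only [orient_hortonPoint, hortonHeight_even]
  push_cast; ring

theorem orient_hortonPoint_odd (δ : ℝ) (i j k : ℕ) :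
    orient (hortonPoint δ (2 * i + 1)) (hortonPoint δ (2 * j + 1)) (hortonPoint δ (2 * k + 1)) =
      2 * δ * orient (hortonPoint δ i) (hortonPoint δ j) (hortonPoint δ k) := by
  simp only [orient_hortonPoint, hortonHeight_odd]
  push_cast; ring

/-- Even points have heights in [0, 2δ], odd ones in [1, 1 + 2δ]. A line through two even points has
slope at most δ in absolute value, so by the choice of δ it stays below the odd layer over the whole
index range. -/
theorem orient_hortonPoint_even_even_odd {δ : ℝ} {n : ℕ} (h0 : 0 < δ) (h1 : 8 * (n + 1) * δ ≤ 1)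
    {i j k : ℕ} (hij : i < j) (hj : 2 * j < n) (hk : 2 * k + 1 < n) :
    0 < orient (hortonPoint δ (2 * i)) (hortonPoint δ (2 * j)) (hortonPoint δ (2 * k + 1)) := by
  have hn : (0 : ℝ) ≤ n := by positivity
  have hδ : δ ≤ 1 / 2 := by nlinarith
  obtain ⟨a0, a1⟩ := hortonHeight_mem h0.le hδ i
  obtain ⟨b0, b1⟩ := hortonHeight_mem h0.le hδ j
  obtain ⟨c0, c1⟩ := hortonHeight_mem h0.le hδ k
  simp only [orient_hortonPoint, hortonHeight_even, hortonHeight_odd]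
  have hij' : (i : ℝ) + 1 ≤ j := by exact_mod_cast hij
  have hj' : (2 : ℝ) * j ≤ n := by exact_mod_cast hj.le
  have hk' : (2 : ℝ) * k + 1 ≤ n := by exact_mod_cast hk.le
  have hi0 : (0 : ℝ) ≤ i := by positivity
  have hk0 : (0 : ℝ) ≤ k := by positivity
  push_cast
  set A := hortonHeight δ i
  set B := hortonHeight δ j
  set C := hortonHeight δ k
  have e1 : δ * (n + 1) * 8 ≤ 1 := by linarith
  have hδ4 : δ * 8 ≤ 1 := by nlinarith
  have t1 : 1 / 2 ≤ 1 + δ * C - δ * A := by nlinarith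
  have t2 : 1 ≤ (2 * (j : ℝ) - 2 * i) * (1 + δ * C - δ * A) := by nlinarith
  have t3 : |(2 * (k : ℝ) + 1 - 2 * i) * (δ * B - δ * A)| ≤ n * (δ * 2) := by
    rw [abs_mul]
    apply mul_le_mul
    · rw [abs_le]; constructor <;> linarith
    · rw [← mul_sub, abs_mul, abs_of_pos h0]
      apply mul_le_mul_of_nonneg_left _ h0.le
      rw [abs_le]; constructor <;> linarith
    · positivity
    · positivity
  have t4 := (abs_le.1 t3).2
  nlinarith

theorem orient_hortonPoint_odd_odd_even {δ : ℝ} {n : ℕ} (h0 : 0 < δ) (h1 : 8 * (n + 1) * δ ≤ 1)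
    {i j k : ℕ} (hij : i < j) (hj : 2 * j + 1 < n) (hk : 2 * k < n) :
    orient (hortonPoint δ (2 * i + 1)) (hortonPoint δ (2 * j + 1)) (hortonPoint δ (2 * k)) < 0 := by
  have hn : (0 : ℝ) ≤ n := by positivity
  have hδ : δ ≤ 1 / 2 := by nlinarith
  obtain ⟨a0, a1⟩ := hortonHeight_mem h0.le hδ i
  obtain ⟨b0, b1⟩ := hortonHeight_mem h0.le hδ j
  obtain ⟨c0, c1⟩ := hortonHeight_mem h0.le hδ k
  simp only [orient_hortonPoint, hortonHeight_even, hortonHeight_odd]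
  have hij' : (i : ℝ) + 1 ≤ j := by exact_mod_cast hij
  have hj' : (2 : ℝ) * j + 1 ≤ n := by exact_mod_cast hj.le
  have hk' : (2 : ℝ) * k ≤ n := by exact_mod_cast hk.le
  have hi0 : (0 : ℝ) ≤ i := by positivity
  have hk0 : (0 : ℝ) ≤ k := by positivity
  push_cast
  set A := hortonHeight δ i
  set B := hortonHeight δ j
  set C := hortonHeight δ k
  have e1 : δ * (n + 1) * 8 ≤ 1 := by linarith
  have hδ4 : δ * 8 ≤ 1 := by nlinarith
  have t1 : 1 / 2 ≤ 1 + δ * A - δ * C := by nlinarith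
  have t2 : 1 ≤ (2 * (j : ℝ) - 2 * i) * (1 + δ * A - δ * C) := by nlinarith
  have t3 : |(2 * (i : ℝ) + 1 - 2 * k) * (δ * B - δ * A)| ≤ n * (δ * 2) := by
    rw [abs_mul]
    apply mul_le_mul
    · rw [abs_le]; constructor <;> linarith
    · rw [← mul_sub, abs_mul, abs_of_pos h0]
      apply mul_le_mul_of_nonneg_left _ h0.le
      rw [abs_le]; constructor <;> linarith
    · positivity
    · positivity
  have t4 := (abs_le.1 t3).2
  nlinarith

theorem InTri.rotate {a b d x : Plane} (h : InTri a b d x) : InTri b d a x :=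
  ⟨h.2.1, h.2.2, h.1⟩

section Horton

variable {δ : ℝ} {n c : ℕ}

/-- Triples meeting both layers are settled by the separation of the layers; triples in one layer
reduce to halved indices. -/
theorem orient_hortonPoint_ne_zero (h0 : 0 < δ) (h1 : 8 * (n + 1) * δ ≤ 1) {i j k : ℕ}
    (hi : i < n) (hj : j < n) (hk : k < n) (hij : i ≠ j) (hik : i ≠ k) (hjk : j ≠ k) :
    orient (hortonPoint δ i) (hortonPoint δ j) (hortonPoint δ k) ≠ 0 := by
  have even : ∀ a b d : ℕ, a ≠ b → 2 * a < n → 2 * b < n → 2 * d + 1 < n →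
      orient (hortonPoint δ (2 * a)) (hortonPoint δ (2 * b)) (hortonPoint δ (2 * d + 1)) ≠ 0 := by
    intro a b d hab ha hb hd
    rcases lt_or_gt_of_ne hab with h | h
    · exact (orient_hortonPoint_even_even_odd h0 h1 h hb hd).ne'
    · rw [orient_swap]
      exact neg_ne_zero.2 (orient_hortonPoint_even_even_odd h0 h1 h ha hd).ne'
  have odd : ∀ a b d : ℕ, a ≠ b → 2 * a + 1 < n → 2 * b + 1 < n → 2 * d < n →
      orient (hortonPoint δ (2 * a + 1)) (hortonPoint δ (2 * b + 1)) (hortonPoint δ (2 * d))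
        ≠ 0 := by
    intro a b d hab ha hb hd
    rcases lt_or_gt_of_ne hab with h | h
    · exact (orient_hortonPoint_odd_odd_even h0 h1 h hb hd).ne
    · rw [orient_swap]
      exact neg_ne_zero.2 (orient_hortonPoint_odd_odd_even h0 h1 h ha hd).ne
  induction hs : i + j + k using Nat.strong_induction_on generalizing i j k with
  | _ s ih =>
    obtain ⟨a, rfl | rfl⟩ := Nat.even_or_odd' i <;> obtain ⟨b, rfl | rfl⟩ := Nat.even_or_odd' j <;>
      obtain ⟨d, rfl | rfl⟩ := Nat.even_or_odd' k
    · rw [orient_hortonPoint_even]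
      exact mul_ne_zero (by positivity) (ih (a + b + d) (by omega) (by omega) (by omega) (by omega)
        (by omega) (by omega) (by omega) rfl)
    · exact even a b d (by omega) hi hj hk
    · rw [← orient_rotate, ← orient_rotate]
      exact even d a b (by omega) hk hi hj
    · rw [← orient_rotate]
      exact odd b d a (by omega) hj hk hi
    · rw [← orient_rotate]
      exact even b d a (by omega) hj hk hi
    · rw [← orient_rotate, ← orient_rotate]
      exact odd d a b (by omega) hk hi hj
    · exact odd a b d (by omega) hi hj hk
    · rw [orient_hortonPoint_odd]
      exact mul_ne_zero (by positivity) (ih (a + b + d) (by omega) (by omega) (by omega) (by omega)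
        (by omega) (by omega) (by omega) rfl)

/-! ### Interior points of triangles with congruent indices -/

/-- If the distance of `u` and `v` is a multiple of the odd number `c`, then at least `(c - 1) / 2`
points of the Horton set between them lie above their line, and as many below. -/
theorem exists_between_hortonPoint (h0 : 0 < δ) (h1 : 8 * (n + 1) * δ ≤ 1) (hc : Odd c)
    {u v m : ℕ} (huv : u < v) (hv : v < n) (hm : v = u + c * m) :
    (∃ Z : Finset ℕ, (c - 1) / 2 ≤ Z.card ∧ ∀ z ∈ Z, u < z ∧ z < v ∧
      0 < orient (hortonPoint δ u) (hortonPoint δ v) (hortonPoint δ z)) ∧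
    (∃ Z : Finset ℕ, (c - 1) / 2 ≤ Z.card ∧ ∀ z ∈ Z, u < z ∧ z < v ∧
      orient (hortonPoint δ u) (hortonPoint δ v) (hortonPoint δ z) < 0) := by
  have inj0 : Function.Injective (fun t : ℕ => 2 * t) := fun a b h => by
    simp only at h; omega
  have inj1 : Function.Injective (fun t : ℕ => 2 * t + 1) := fun a b h => by
    simp only at h; omega
  have hcm : c ≤ c * m := Nat.le_mul_of_pos_right c (by
    rcases Nat.eq_zero_or_pos m with rfl | h
    · simp at hm; omega
    · exact h)
  induction v using Nat.strong_induction_on generalizing u m with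
  | _ v ih =>
    -- Oddness of `c` enters here: 2(b - a) = cm forces `m` to be even, so the halved distance is
    -- again a multiple of `c`.
    have half : ∀ a b : ℕ, 2 * b = 2 * a + c * m → a < b → ∃ m', b = a + c * m' ∧ c ≤ c * m' := by
      intro a b hab hlt
      have h2 : Even (c * m) := ⟨b - a, by omega⟩
      have h3 : Even m := (Nat.even_mul.1 h2).resolve_left (Nat.not_even_iff_odd.2 hc)
      obtain ⟨m', rfl⟩ := h3
      rw [mul_add] at hab
      refine ⟨m', by omega, Nat.le_mul_of_pos_right c (Nat.pos_of_ne_zero ?_)⟩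
      rintro rfl
      simp at hab; omega
    obtain ⟨a, rfl | rfl⟩ := Nat.even_or_odd' u <;> obtain ⟨b, rfl | rfl⟩ := Nat.even_or_odd' v
    · obtain ⟨m', hm', hcm'⟩ := half a b hm (by omega)
      obtain ⟨⟨Z, hZ, hZ'⟩, W, hW, hW'⟩ := ih b (by omega) (by omega) (by omega) hm' hcm'
      refine ⟨⟨Z.image (fun t => 2 * t), by rwa [Finset.card_image_of_injective _ inj0], ?_⟩,
        W.image (fun t => 2 * t), by rwa [Finset.card_image_of_injective _ inj0], ?_⟩
      · simp only [Finset.forall_mem_image]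
        intro z hz
        obtain ⟨h2, h3, h4⟩ := hZ' z hz
        rw [orient_hortonPoint_even]
        exact ⟨by omega, by omega, by positivity⟩
      · simp only [Finset.forall_mem_image]
        intro z hz
        obtain ⟨h2, h3, h4⟩ := hW' z hz
        rw [orient_hortonPoint_even]
        exact ⟨by omega, by omega, mul_neg_of_pos_of_neg (by positivity) h4⟩
    -- The segment joins the two layers, so odd points between its ends are above it and even points
    -- below. The half-open intervals omit the endpoints `2 * b + 1` and `2 * a` themselves.
    · refine ⟨⟨(Finset.Ico a b).image (fun t => 2 * t + 1), ?_, ?_⟩,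
        (Finset.Ioc a b).image (fun t => 2 * t), ?_, ?_⟩
      · rw [Finset.card_image_of_injective _ inj1, Nat.card_Ico]; omega
      · simp only [Finset.forall_mem_image, Finset.mem_Ico]
        intro t ht
        refine ⟨by omega, by omega, ?_⟩
        have := orient_hortonPoint_odd_odd_even h0 h1 ht.2 hv (by omega : 2 * a < n)
        rw [← orient_rotate, orient_swap] at this
        linarith
      · rw [Finset.card_image_of_injective _ inj0, Nat.card_Ioc]; omega
      · simp only [Finset.forall_mem_image, Finset.mem_Ioc]
        intro t ht
        refine ⟨by omega, by omega, ?_⟩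
        have := orient_hortonPoint_even_even_odd h0 h1 ht.1 (by omega : 2 * t < n) hv
        rw [orient_swap_right]
        linarith
    · refine ⟨⟨(Finset.Ioo a b).image (fun t => 2 * t + 1), ?_, ?_⟩,
        (Finset.Ioo a b).image (fun t => 2 * t), ?_, ?_⟩
      · rw [Finset.card_image_of_injective _ inj1, Nat.card_Ioo]; omega
      · simp only [Finset.forall_mem_image, Finset.mem_Ioo]
        intro t ht
        refine ⟨by omega, by omega, ?_⟩
        have := orient_hortonPoint_odd_odd_even h0 h1 ht.1 (by omega : 2 * t + 1 < n) hv
        rw [orient_swap_right]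
        linarith
      · rw [Finset.card_image_of_injective _ inj0, Nat.card_Ioo]; omega
      · simp only [Finset.forall_mem_image, Finset.mem_Ioo]
        intro t ht
        refine ⟨by omega, by omega, ?_⟩
        have := orient_hortonPoint_even_even_odd h0 h1 ht.2 hv (by omega : 2 * a + 1 < n)
        rw [orient_rotate, orient_swap_right]
        linarith
    · obtain ⟨m', hm', hcm'⟩ := half a b (by omega) (by omega)
      obtain ⟨⟨Z, hZ, hZ'⟩, W, hW, hW'⟩ := ih b (by omega) (by omega) (by omega) hm' hcm'
      refine ⟨⟨Z.image (fun t => 2 * t + 1), by rwa [Finset.card_image_of_injective _ inj1], ?_⟩,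
        W.image (fun t => 2 * t + 1), by rwa [Finset.card_image_of_injective _ inj1], ?_⟩
      · simp only [Finset.forall_mem_image]
        intro z hz
        obtain ⟨h2, h3, h4⟩ := hZ' z hz
        rw [orient_hortonPoint_odd]
        exact ⟨by omega, by omega, by positivity⟩
      · simp only [Finset.forall_mem_image]
        intro z hz
        obtain ⟨h2, h3, h4⟩ := hW' z hz
        rw [orient_hortonPoint_odd]
        exact ⟨by omega, by omega, mul_neg_of_pos_of_neg (by positivity) h4⟩

theorem exists_eq_add_mul_of_modEq {a b : ℕ} (hab : a ≤ b) (h : a ≡ b [MOD c]) :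
    ∃ m, b = a + c * m := by
  obtain ⟨m, hm⟩ := (Nat.modEq_iff_dvd' hab).1 h
  exact ⟨m, by omega⟩

/-- The odd apex is above every line through two even points, so an even point between the base
vertices and above the base is inside. The bound on `z` keeps these points within the first `n`. -/
theorem exists_inTri_even_even_odd (h0 : 0 < δ) (h1 : 8 * (n + 1) * δ ≤ 1) (hc : Odd c)
    {a b d : ℕ} (ha : 2 * a < n) (hb : 2 * b < n) (hd : 2 * d + 1 < n) (hab : a ≡ b [MOD c])
    (ho : 0 < orient (hortonPoint δ (2 * a)) (hortonPoint δ (2 * b)) (hortonPoint δ (2 * d + 1))) :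
    ∃ Z : Finset ℕ, (c - 1) / 2 ≤ Z.card ∧ ∀ z ∈ Z, (z < 2 * a ∨ z < 2 * b ∨ z < 2 * d + 1) ∧
      InTri (hortonPoint δ (2 * a))
      (hortonPoint δ (2 * b)) (hortonPoint δ (2 * d + 1)) (hortonPoint δ z) := by
  have inj0 : Function.Injective (fun t : ℕ => 2 * t) := fun a b h => by
    simp only at h; omega
  have hlt : a < b := by
    rcases lt_trichotomy a b with h | rfl | h
    · exact h
    · simp at ho
    · have := orient_hortonPoint_even_even_odd h0 h1 h ha hd
      rw [orient_swap] at this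
      linarith
  obtain ⟨m, hm⟩ := exists_eq_add_mul_of_modEq hlt.le hab
  obtain ⟨⟨Z, hZ, hZ'⟩, -⟩ := exists_between_hortonPoint h0 h1 hc hlt (by omega) hm
  refine ⟨Z.image (fun t => 2 * t), by rwa [Finset.card_image_of_injective _ inj0], ?_⟩
  simp only [Finset.forall_mem_image]
  intro z hz
  obtain ⟨h2, h3, h4⟩ := hZ' z hz
  refine ⟨by omega, ?_, ?_, ?_⟩
  · rw [orient_hortonPoint_even]; positivity
  · rw [orient_rotate]
    exact orient_hortonPoint_even_even_odd h0 h1 h3 hb hd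
  · rw [orient_rotate, orient_rotate]
    exact orient_hortonPoint_even_even_odd h0 h1 h2 (by omega) hd

theorem exists_inTri_odd_odd_even (h0 : 0 < δ) (h1 : 8 * (n + 1) * δ ≤ 1) (hc : Odd c)
    {a b d : ℕ} (ha : 2 * a + 1 < n) (hb : 2 * b + 1 < n) (hd : 2 * d < n) (hab : a ≡ b [MOD c])
    (ho : 0 < orient (hortonPoint δ (2 * a + 1)) (hortonPoint δ (2 * b + 1))
      (hortonPoint δ (2 * d))) :
    ∃ Z : Finset ℕ, (c - 1) / 2 ≤ Z.card ∧ ∀ z ∈ Z,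
      (z < 2 * a + 1 ∨ z < 2 * b + 1 ∨ z < 2 * d) ∧ InTri (hortonPoint δ (2 * a + 1))
      (hortonPoint δ (2 * b + 1)) (hortonPoint δ (2 * d)) (hortonPoint δ z) := by
  have inj1 : Function.Injective (fun t : ℕ => 2 * t + 1) := fun a b h => by
    simp only at h; omega
  have hlt : b < a := by
    rcases lt_trichotomy b a with h | rfl | h
    · exact h
    · simp at ho
    · have := orient_hortonPoint_odd_odd_even h0 h1 h hb hd
      linarith
  obtain ⟨m, hm⟩ := exists_eq_add_mul_of_modEq hlt.le hab.symm
  obtain ⟨-, Z, hZ, hZ'⟩ := exists_between_hortonPoint h0 h1 hc hlt (by omega) hm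
  refine ⟨Z.image (fun t => 2 * t + 1), by rwa [Finset.card_image_of_injective _ inj1], ?_⟩
  simp only [Finset.forall_mem_image]
  intro z hz
  obtain ⟨h2, h3, h4⟩ := hZ' z hz
  refine ⟨by omega, ?_, ?_, ?_⟩
  · rw [orient_hortonPoint_odd]
    rw [orient_swap] at h4
    have : 0 < orient (hortonPoint δ a) (hortonPoint δ b) (hortonPoint δ z) := by linarith
    positivity
  · rw [orient_rotate, orient_swap]
    exact neg_pos.2 (orient_hortonPoint_odd_odd_even h0 h1 h2 (by omega) hd)
  · rw [orient_rotate, orient_rotate, orient_swap]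
    exact neg_pos.2 (orient_hortonPoint_odd_odd_even h0 h1 h3 ha hd)

/-- A triangle of a Horton set with vertices congruent modulo the odd number `c` has at least
`(c - 1) / 2` interior points. -/
theorem exists_inTri_hortonPoint (h0 : 0 < δ) (h1 : 8 * (n + 1) * δ ≤ 1) (hc : Odd c) {i j k : ℕ}
    (hi : i < n) (hj : j < n) (hk : k < n) (hij : i ≡ j [MOD c]) (hjk : j ≡ k [MOD c])
    (ho : 0 < orient (hortonPoint δ i) (hortonPoint δ j) (hortonPoint δ k)) :
    ∃ Z : Finset ℕ, (c - 1) / 2 ≤ Z.card ∧ ∀ z ∈ Z, (z < i ∨ z < j ∨ z < k) ∧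
      InTri (hortonPoint δ i) (hortonPoint δ j) (hortonPoint δ k) (hortonPoint δ z) := by
  have inj0 : Function.Injective (fun t : ℕ => 2 * t) := fun a b h => by
    simp only at h; omega
  have inj1 : Function.Injective (fun t : ℕ => 2 * t + 1) := fun a b h => by
    simp only at h; omega
  have cop : Nat.gcd c 2 = 1 := hc.coprime_two_right
  have half0 : ∀ a b, 2 * a ≡ 2 * b [MOD c] → a ≡ b [MOD c] := fun a b h =>
    Nat.ModEq.cancel_left_of_coprime cop h
  have half1 : ∀ a b, 2 * a + 1 ≡ 2 * b + 1 [MOD c] → a ≡ b [MOD c] := fun a b h =>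
    half0 a b (Nat.ModEq.add_right_cancel' 1 h)
  have hki := (hij.trans hjk).symm
  induction hs : i + j + k using Nat.strong_induction_on generalizing i j k with
  | _ s ih =>
    obtain ⟨a, rfl | rfl⟩ := Nat.even_or_odd' i <;> obtain ⟨b, rfl | rfl⟩ := Nat.even_or_odd' j <;>
      obtain ⟨d, rfl | rfl⟩ := Nat.even_or_odd' k
    · rw [orient_hortonPoint_even] at ho
      have ho' := pos_of_mul_pos_right ho (by positivity)
      have hne : a ≠ b := by rintro rfl; simp at ho
      obtain ⟨Z, hZ, hZ'⟩ := ih (a + b + d) (by omega) (by omega) (by omega) (by omega)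
        (half0 _ _ hij) (half0 _ _ hjk) ho' (half0 _ _ hki) rfl
      refine ⟨Z.image (fun t => 2 * t), by rwa [Finset.card_image_of_injective _ inj0], ?_⟩
      simp only [Finset.forall_mem_image]
      intro z hz
      obtain ⟨h2, h3, h4, h5⟩ := hZ' z hz
      refine ⟨by omega, ?_, ?_, ?_⟩ <;> rw [orient_hortonPoint_even] <;> positivity
    · exact exists_inTri_even_even_odd h0 h1 hc hi hj hk (half0 _ _ hij) ho
    · rw [← orient_rotate, ← orient_rotate] at ho
      obtain ⟨Z, hZ, hZ'⟩ := exists_inTri_even_even_odd h0 h1 hc hk hi hj (half0 _ _ hki) ho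
      exact ⟨Z, hZ, fun z hz => ⟨by have := (hZ' z hz).1; tauto, (hZ' z hz).2.rotate⟩⟩
    · rw [← orient_rotate] at ho
      obtain ⟨Z, hZ, hZ'⟩ := exists_inTri_odd_odd_even h0 h1 hc hj hk hi (half1 _ _ hjk) ho
      exact ⟨Z, hZ, fun z hz => ⟨by have := (hZ' z hz).1; tauto, (hZ' z hz).2.rotate.rotate⟩⟩
    · rw [← orient_rotate] at ho
      obtain ⟨Z, hZ, hZ'⟩ := exists_inTri_even_even_odd h0 h1 hc hj hk hi (half0 _ _ hjk) ho
      exact ⟨Z, hZ, fun z hz => ⟨by have := (hZ' z hz).1; tauto, (hZ' z hz).2.rotate.rotate⟩⟩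
    · rw [← orient_rotate, ← orient_rotate] at ho
      obtain ⟨Z, hZ, hZ'⟩ := exists_inTri_odd_odd_even h0 h1 hc hk hi hj (half1 _ _ hki) ho
      exact ⟨Z, hZ, fun z hz => ⟨by have := (hZ' z hz).1; tauto, (hZ' z hz).2.rotate⟩⟩
    · exact exists_inTri_odd_odd_even h0 h1 hc hi hj hk (half1 _ _ hij) ho
    · rw [orient_hortonPoint_odd] at ho
      have ho' := pos_of_mul_pos_right ho (by positivity)
      obtain ⟨Z, hZ, hZ'⟩ := ih (a + b + d) (by omega) (by omega) (by omega) (by omega)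
        (half1 _ _ hij) (half1 _ _ hjk) ho' (half1 _ _ hki) rfl
      refine ⟨Z.image (fun t => 2 * t + 1), by rwa [Finset.card_image_of_injective _ inj1], ?_⟩
      simp only [Finset.forall_mem_image]
      intro z hz
      obtain ⟨h2, h3, h4, h5⟩ := hZ' z hz
      refine ⟨by omega, ?_, ?_, ?_⟩ <;> rw [orient_hortonPoint_odd] <;> positivity

/-! ### The lower bound -/

open Classical in
theorem not_forces_triangle {c s : ℕ} (hs : s < (c - 1) / 2) (N : ℕ) : ¬ Forces 3 c s N := by
  intro hF
  set k := (c - 1) / 2 with hk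
  set c' := 2 * k + 1 with hc'
  have hc'c : c' = c ∨ c' + 1 = c := by omega
  set n := N + c with hn
  obtain ⟨δ, h0, h1⟩ : ∃ δ : ℝ, 0 < δ ∧ 8 * ((n : ℝ) + 1) * δ ≤ 1 :=
    ⟨1 / (8 * ((n : ℝ) + 1)), by positivity, by field_simp; rfl⟩
  set S : Finset Plane := (Finset.range n).image (hortonPoint δ) with hS
  have hgen : GeneralPosition S := by
    intro p hp q hq r hr hpq hpr hqr hcol
    obtain ⟨i, hi, rfl⟩ := Finset.mem_image.1 hp
    obtain ⟨j, hj, rfl⟩ := Finset.mem_image.1 hq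
    obtain ⟨l, hl, rfl⟩ := Finset.mem_image.1 hr
    rw [Finset.mem_range] at hi hj hl
    exact orient_hortonPoint_ne_zero h0 h1 hi hj hl (by rintro rfl; exact hpq rfl)
      (by rintro rfl; exact hpr rfl) (by rintro rfl; exact hqr rfl)
      ((collinear_iff_orient hpq).1 hcol)
  have hcard : S.card = n := by
    rw [Finset.card_image_of_injective _ (hortonPoint_injective δ), Finset.card_range]
  -- The first `c` points receive distinct colors so that no class is empty. If `c` is even, the
  -- last color is used only once; all other repetitions of a color are congruences modulo `c'`.
  set f : ℕ → ℕ := fun i => if i < c then i else i % c' with hf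
  have hfc : ∀ i, f i < c := by
    intro i
    simp only [hf]
    split_ifs with h
    · exact h
    · have := Nat.mod_lt i (show c' > 0 by omega); omega
  have hfmod : ∀ i j, i ≠ j → f i = f j → i ≡ j [MOD c'] := by
    have aux : ∀ i, (i < c ∧ f i = i) ∨ (c ≤ i ∧ f i = i % c') := by
      intro i
      simp only [hf]
      split_ifs with h
      · exact Or.inl ⟨h, rfl⟩
      · exact Or.inr ⟨by omega, rfl⟩
    intro i j hij h
    have mi := Nat.mod_lt i (show c' > 0 by omega)
    have mj := Nat.mod_lt j (show c' > 0 by omega)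
    unfold Nat.ModEq
    rcases aux i with ⟨a1, a2⟩ | ⟨a1, a2⟩ <;> rcases aux j with ⟨b1, b2⟩ | ⟨b1, b2⟩
    · omega
    · rw [Nat.mod_eq_of_lt (by omega : i < c')]; omega
    · rw [Nat.mod_eq_of_lt (by omega : j < c')]; omega
    · omega
  set col : Plane → Fin c := fun x => ⟨f ⌊x 0⌋₊, hfc _⟩ with hcol
  have hcolH : ∀ i, (col (hortonPoint δ i) : ℕ) = f i := by
    intro i
    simp [hcol, hortonPoint]
  have hcoloring : IsColoring S col := by
    intro i
    refine ⟨hortonPoint δ i, Finset.mem_image_of_mem _ (by simp; omega), Fin.ext ?_⟩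
    rw [hcolH]
    simp [hf]
  have main : ∀ i j l, i < n → j < n → l < n → i ≠ j → j ≠ l →
      (∃ t, ∀ p ∈ ({hortonPoint δ i, hortonPoint δ j, hortonPoint δ l} : Finset Plane),
        col p = t) →
      0 < orient (hortonPoint δ i) (hortonPoint δ j) (hortonPoint δ l) →
      s < interiorCount S {hortonPoint δ i, hortonPoint δ j, hortonPoint δ l} := by
    intro i j l hi hj hl hij hjl ⟨t, ht⟩ ho
    have ti := congrArg Fin.val (ht (hortonPoint δ i) (by simp))
    have tj := congrArg Fin.val (ht (hortonPoint δ j) (by simp))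
    have tl := congrArg Fin.val (ht (hortonPoint δ l) (by simp))
    rw [hcolH] at ti tj tl
    obtain ⟨Z, hZ, hZ'⟩ := exists_inTri_hortonPoint h0 h1 (c := c') ⟨k, hc'⟩ hi hj hl
      (hfmod i j hij (ti.trans tj.symm)) (hfmod j l hjl (tj.trans tl.symm)) ho
    rw [interiorCount_triple S ho]
    calc s < k := hs
      _ ≤ Z.card := by omega
      _ = (Z.image (hortonPoint δ)).card :=
        (Finset.card_image_of_injective _ (hortonPoint_injective δ)).symm
      _ ≤ _ := by
        apply Finset.card_le_card
        intro x hx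
        obtain ⟨z, hz, rfl⟩ := Finset.mem_image.1 hx
        obtain ⟨h2, h3⟩ := hZ' z hz
        exact Finset.mem_filter.2 ⟨Finset.mem_image_of_mem _ (Finset.mem_range.2 (by omega)), h3⟩
  obtain ⟨T, hTS, hT3, -, hmono, hcount⟩ := hF S hgen (by omega) col hcoloring
  obtain ⟨a, b, d, hab, had, hbd, rfl⟩ := Finset.card_eq_three.1 hT3
  obtain ⟨i, hi, rfl⟩ := Finset.mem_image.1 (hTS (by simp : a ∈ _))
  obtain ⟨j, hj, rfl⟩ := Finset.mem_image.1 (hTS (by simp : b ∈ _))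
  obtain ⟨l, hl, rfl⟩ := Finset.mem_image.1 (hTS (by simp : d ∈ _))
  rw [Finset.mem_range] at hi hj hl
  have hij : i ≠ j := by rintro rfl; exact hab rfl
  have hil : i ≠ l := by rintro rfl; exact had rfl
  have hjl : j ≠ l := by rintro rfl; exact hbd rfl
  rcases lt_or_gt_of_ne (orient_hortonPoint_ne_zero h0 h1 hi hj hl hij hil hjl) with h | h
  · have h2 : 0 < orient (hortonPoint δ j) (hortonPoint δ i) (hortonPoint δ l) := by
      rw [orient_swap]; linarith
    rw [Finset.insert_comm] at hmono hcount
    have := main j i l hj hi hl hij.symm hil hmono h2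
    omega
  · have := main i j l hi hj hl hij hjl hmono h
    omega

end Horton

/-! ### Sectors and convex chains of a fan -/

/-- `q 0, …, q (n - 1)` are in angular order around `p`. -/
def IsFan (p : Plane) (q : ℕ → Plane) (n : ℕ) : Prop :=
  ∀ i j, i < j → j < n → 0 < orient p (q i) (q j)

namespace IsFan

variable {p : Plane} {q : ℕ → Plane} {n : ℕ}

theorem nonneg (hq : IsFan p q n) {i j : ℕ} (hij : i ≤ j) (hj : j < n) :
    0 ≤ orient p (q i) (q j) := by
  rcases hij.eq_or_lt with rfl | h
  · simp
  · exact (hq i j h hj).le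

theorem right_of_sector (hq : IsFan p q n) {i k j : ℕ} {x : Plane} (hik : i < k) (hkj : k ≤ j)
    (hj : j < n) (h1 : 0 < orient p (q i) x) (h2 : 0 < orient p x (q k)) :
    0 < orient p x (q j) := by
  -- Three-term Grassmann–Plücker relation for the vectors from `p` to the four other points.
  have e : orient p x (q j) * orient p (q i) (q k) =
      orient p x (q k) * orient p (q i) (q j) + orient p (q i) x * orient p (q k) (q j) := by
    unfold orient; ring
  have h3 := hq i j (by omega) hj
  have h4 := hq i k hik (by omega)
  have h5 := hq.nonneg hkj hj
  refine pos_of_mul_pos_left (b := orient p (q i) (q k)) ?_ h4.le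
  rw [e]; positivity

theorem left_of_sector (hq : IsFan p q n) {i k j : ℕ} {x : Plane} (hik : i < k) (hji : j ≤ i)
    (hk : k < n) (h1 : 0 < orient p (q i) x) (h2 : 0 < orient p x (q k)) :
    0 < orient p (q j) x := by
  have e : orient p (q j) x * orient p (q i) (q k) =
      orient p (q i) x * orient p (q j) (q k) + orient p x (q k) * orient p (q j) (q i) := by
    unfold orient; ring
  have h3 := hq j k (by omega) hk
  have h4 := hq i k hik hk
  have h5 := hq.nonneg hji (by omega)
  refine pos_of_mul_pos_left (b := orient p (q i) (q k)) ?_ h4.le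
  rw [e]; positivity

/-- Points in two sectors that do not overlap are different. -/
theorem not_mem_both (hq : IsFan p q n) {i k i' k' : ℕ} {x : Plane} (hik : i < k) (hki : k ≤ i')
    (hik' : i' < k') (hk' : k' < n) (h1 : 0 < orient p (q i) x) (h2 : 0 < orient p x (q k))
    (h3 : 0 < orient p (q i') x) : False := by
  have := hq.right_of_sector hik hki (by omega) h1 h2
  rw [orient_swap_right] at this
  linarith

theorem sector_of_inTri {x u v : Plane} (h : InTri p u v x) :
    0 < orient p u x ∧ 0 < orient p x v := by
  refine ⟨h.1, ?_⟩
  rw [orient_rotate]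
  exact h.2.2

theorem index_of_sector (hq : IsFan p q n) {i j k : ℕ} (hi : i < n) (hj : j < n)
    (h1 : 0 < orient p (q i) (q j)) (h2 : 0 < orient p (q j) (q k)) :
    i < j ∧ j < k := by
  constructor
  · by_contra! h
    have := hq.nonneg h hi
    rw [orient_swap_right] at this
    linarith
  · by_contra! h
    have := hq.nonneg h hj
    rw [orient_swap_right] at this
    linarith

/-- A reflex triangle lies in the sector of its outer vertices. -/
theorem sector_of_inTri_reflex (hq : IsFan p q n) {i : ℕ} (hi : i + 2 < n) {x : Plane}
    (h : InTri (q i) (q (i + 2)) (q (i + 1)) x) :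
    0 < orient p (q i) x ∧ 0 < orient p x (q (i + 2)) := by
  have h1 := hq i (i + 1) (by omega) (by omega)
  have h2 := hq i (i + 2) (by omega) (by omega)
  have h3 := hq (i + 1) (i + 2) (by omega) (by omega)
  refine ⟨h.pos_of_nonneg (by simp) h2.le h1.le (by tauto), ?_⟩
  rw [← orient_rotate] at h2 h3
  rw [← orient_rotate, ← orient_rotate]
  rw [← orient_rotate] at h2 h3
  exact h.pos_of_nonneg h2.le (by simp) h3.le (by tauto)

/-- Local convexity of a chain implies global convexity. -/
theorem chain_left (hq : IsFan p q n) {a b : ℕ} (hb : b < n)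
    (hconv : ∀ i, a ≤ i → i + 2 ≤ b → 0 < orient (q i) (q (i + 1)) (q (i + 2))) {l : ℕ}
    (hl : l + 1 ≤ b) : ∀ i, a ≤ i → i < l → 0 < orient (q i) (q l) (q (l + 1)) := by
  induction l with
  | zero => intro i _ h; omega
  | succ l ih =>
    intro i hai hil
    rcases (by omega : i = l ∨ i < l) with rfl | h
    · exact hconv i hai hl
    · have h1 := ih (by omega) i hai h
      have h2 := hconv l (by omega) hl
      have h3 := hq l (l + 1) (by omega) (by omega)
      have h4 := hq (l + 1) (l + 2) (by omega) (by omega)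
      have h5 := hq i (l + 1) (by omega) (by omega)
      -- Grassmann–Plücker relation again, now with pivot `q (l + 1)`.
      have e : orient (q i) (q (l + 1)) (q (l + 2)) * orient p (q l) (q (l + 1)) =
          orient (q i) (q l) (q (l + 1)) * orient p (q (l + 1)) (q (l + 2)) +
          orient p (q i) (q (l + 1)) * orient (q l) (q (l + 1)) (q (l + 2)) := by
        unfold orient; ring
      refine pos_of_mul_pos_left (b := orient p (q l) (q (l + 1))) ?_ h3.le
      rw [e]; positivity

theorem chain_right (hq : IsFan p q n) {a b : ℕ} (hb : b < n)
    (hconv : ∀ i, a ≤ i → i + 2 ≤ b → 0 < orient (q i) (q (i + 1)) (q (i + 2))) {k : ℕ} :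
    ∀ l, a ≤ l → l + 2 + k ≤ b → 0 < orient (q l) (q (l + 1)) (q (l + 2 + k)) := by
  induction k with
  | zero => intro l hal hl; exact hconv l hal hl
  | succ k ih =>
    intro l hal hl
    have h1 := ih (l + 1) (by omega) (by omega)
    rw [show l + 1 + 2 + k = l + 2 + (k + 1) by ring] at h1
    have h2 := hconv l hal (by omega)
    have h3 := hq l (l + 1) (by omega) (by omega)
    have h4 := hq (l + 1) (l + 2) (by omega) (by omega)
    have h5 := hq (l + 1) (l + 2 + (k + 1)) (by omega) (by omega)
    have e : orient (q l) (q (l + 1)) (q (l + 2 + (k + 1))) * orient p (q (l + 1)) (q (l + 2)) =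
        orient (q l) (q (l + 1)) (q (l + 2)) * orient p (q (l + 1)) (q (l + 2 + (k + 1))) +
        orient p (q l) (q (l + 1)) *
          orient (q (l + 1)) (q (l + 2)) (q (l + 2 + (k + 1))) := by
      unfold orient; ring
    refine pos_of_mul_pos_left (b := orient p (q (l + 1)) (q (l + 2))) ?_ h4.le
    rw [e]; positivity

theorem chain_nonneg (hq : IsFan p q n) {a b : ℕ} (hb : b < n)
    (hconv : ∀ i, a ≤ i → i + 2 ≤ b → 0 < orient (q i) (q (i + 1)) (q (i + 2))) {l i : ℕ}
    (hl : a ≤ l) (hlb : l + 1 ≤ b) (hi : a ≤ i) (hib : i ≤ b) :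
    0 ≤ orient (q l) (q (l + 1)) (q i) := by
  rcases (by omega : i < l ∨ i = l ∨ i = l + 1 ∨ l + 2 ≤ i) with h | rfl | rfl | h
  · rw [orient_rotate]
    exact (hq.chain_left hb hconv hlb i hi h).le
  · simp
  · simp
  · obtain ⟨k, rfl⟩ := Nat.exists_eq_add_of_le h
    exact (hq.chain_right hb hconv l hl hib).le

end IsFan

/-! ### Counting points and the upper bound -/

section Count

open Classical

variable {c : ℕ} {S : Finset Plane} {col : Plane → Fin c}

/-- Every positively oriented monochromatic triangle of `S` has at least `m` interior points. -/
def TrianglesContain (S : Finset Plane) (col : Plane → Fin c) (m : ℕ) : Prop :=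
  ∀ a ∈ S, ∀ b ∈ S, ∀ d ∈ S, col b = col a → col d = col a → 0 < orient a b d →
    m ≤ (S.filter (InTri a b d)).card

/-- The triangles between consecutive points of a fan are interior disjoint. -/
theorem fan_card {m n a b : ℕ} (hS : TrianglesContain S col m) {p : Plane} {q : ℕ → Plane}
    (hq : IsFan p q n) (hb : b < n) (hp : p ∈ S) (hqS : ∀ i < n, q i ∈ S)
    (hqc : ∀ i < n, col (q i) = col p) :
    (b - a) * m ≤ (S.filter fun x => ∃ i, a ≤ i ∧ i < b ∧ InTri p (q i) (q (i + 1)) x).card := by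
  have e : (S.filter fun x => ∃ i, a ≤ i ∧ i < b ∧ InTri p (q i) (q (i + 1)) x) =
      (Finset.Ico a b).biUnion fun i => S.filter (InTri p (q i) (q (i + 1))) := by
    ext x
    simp only [Finset.mem_filter, Finset.mem_biUnion, Finset.mem_Ico]
    constructor
    · rintro ⟨h, i, h1, h2, h3⟩; exact ⟨i, ⟨h1, h2⟩, h, h3⟩
    · rintro ⟨i, ⟨h1, h2⟩, h, h3⟩; exact ⟨h, i, h1, h2, h3⟩
  have disj : ∀ i j x, i < j → j < b → InTri p (q i) (q (i + 1)) x →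
      InTri p (q j) (q (j + 1)) x → False := by
    intro i j x hij hj h1 h2
    obtain ⟨h3, h4⟩ := IsFan.sector_of_inTri h1
    obtain ⟨h5, h6⟩ := IsFan.sector_of_inTri h2
    exact hq.not_mem_both (by omega) (by omega) (by omega : j < j + 1) (by omega) h3 h4 h5
  rw [e, Finset.card_biUnion]
  · rw [← Nat.card_Ico, ← smul_eq_mul]
    apply Finset.card_nsmul_le_sum
    intro i hi
    rw [Finset.mem_Ico] at hi
    exact hS p hp _ (hqS i (by omega)) _ (hqS (i + 1) (by omega)) (hqc i (by omega))
      (hqc (i + 1) (by omega)) (hq i (i + 1) (by omega) (by omega))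
  · intro i hi j hj hij
    simp only [Finset.coe_Ico, Set.mem_Ico] at hi hj
    rw [Function.onFun, Finset.disjoint_left]
    intro x hx hx'
    rw [Finset.mem_filter] at hx hx'
    rcases lt_or_gt_of_ne hij with h | h
    · exact disj i j x h hj.2 hx.2 hx'.2
    · exact disj j i x h hi.2 hx'.2 hx.2

/-- No vertex of a fan lies in a triangle between consecutive points of the fan. -/
theorem ne_of_inTri_fan {n i : ℕ} {p : Plane} {q : ℕ → Plane} (hq : IsFan p q n) (hi : i + 1 < n)
    {x : Plane} (hx : InTri p (q i) (q (i + 1)) x) : ¬ (x = p ∨ ∃ j < n, x = q j) := by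
  rintro (rfl | ⟨j, hj, rfl⟩)
  · simp [InTri] at hx
  · obtain ⟨h1, h2⟩ := IsFan.sector_of_inTri hx
    have := hq.index_of_sector (by omega) hj h1 h2
    omega

theorem GeneralPosition.mono {T : Finset Plane} (hS : GeneralPosition S) (h : T ⊆ S) :
    GeneralPosition T :=
  fun p hp q hq r hr => hS p (h hp) q (h hq) r (h hr)

theorem exists_fan_of_color (hgen : GeneralPosition S) {t : Fin c} {n : ℕ}
    (hn : (S.filter fun x => col x = t).card = n + 1) :
    ∃ p ∈ S, col p = t ∧ ∃ q : ℕ → Plane, (∀ i < n, q i ∈ S) ∧ (∀ i < n, col (q i) = t) ∧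
      IsFan p q n ∧ ∀ x ∈ S, col x = t → x = p ∨ ∃ i < n, x = q i := by
  obtain ⟨p, hp, q, h1, h2, h3⟩ := exists_fan (hgen.mono (Finset.filter_subset _ S)) hn
  rw [Finset.mem_filter] at hp
  exact ⟨p, hp.1, hp.2, q, fun i hi => (Finset.mem_filter.1 (h1 i hi)).1,
    fun i hi => (Finset.mem_filter.1 (h1 i hi)).2, h2,
    fun x hx hxt => h3 x (Finset.mem_filter.2 ⟨hx, hxt⟩)⟩

theorem card_le_of_forall_color_card_le (J : Finset (Fin c)) {n : ℕ} {X : Finset Plane}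
    (hX : ∀ x ∈ X, col x ∈ J) (hn : ∀ i ∈ J, (X.filter fun x => col x = i).card ≤ n) :
    X.card ≤ J.card * n := by
  rw [Finset.card_eq_sum_card_fiberwise (f := col) (t := J) hX, ← smul_eq_mul]
  exact Finset.sum_le_card_nsmul _ _ _ hn

/-- A largest class with k + 2 points has k fan triangles, holding at least k(e + 1) points. Only e
other colors occur, so k(e + 1) ≤ e(k + 2), whence k ≤ 2e. -/
theorem card_le_of_missing_color {e : ℕ} {col : Plane → Fin (e + 2)} (hgen : GeneralPosition S)
    (hS : TrianglesContain S col (e + 1)) {t : Fin (e + 2)} (ht : ∀ x ∈ S, col x ≠ t) :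
    S.card ≤ (e + 1) * (2 * (e + 1)) := by
  set J : Finset (Fin (e + 2)) := Finset.univ.erase t with hJ
  have hJcard : J.card = e + 1 := by simp [hJ]
  obtain ⟨j, hj, hmax⟩ := J.exists_max_image (fun i => (S.filter fun x => col x = i).card)
    (Finset.card_pos.1 (by omega))
  set n := (S.filter fun x => col x = j).card with hn
  have h1 : S.card ≤ (e + 1) * n := by
    rw [← hJcard]
    exact card_le_of_forall_color_card_le J (fun x hx => by simp [hJ, ht x hx]) hmax
  refine h1.trans (Nat.mul_le_mul_left _ ?_)
  by_contra! hlt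
  obtain ⟨k, hk⟩ : ∃ k, n = k + 2 := ⟨n - 2, by omega⟩
  obtain ⟨p, hp, hpc, q, hqS, hqc, hq, hall⟩ := exists_fan_of_color hgen (hn.symm.trans hk)
  have h2 := fan_card (a := 0) (b := k) hS hq (by omega) hp hqS
    (fun i hi => (hqc i hi).trans hpc.symm)
  set U := S.filter fun x => ∃ i, 0 ≤ i ∧ i < k ∧ InTri p (q i) (q (i + 1)) x
  have hU : ∀ x ∈ U, x ∈ S ∧ col x ≠ j := by
    intro x hx
    obtain ⟨hxS, i, -, hi, hxi⟩ := Finset.mem_filter.1 hx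
    exact ⟨hxS, fun hxj => ne_of_inTri_fan hq (by omega) hxi (hall x hxS hxj)⟩
  have h3 : U.card ≤ e * n := by
    have hc : (J.erase j).card = e := by rw [Finset.card_erase_of_mem hj]; omega
    rw [← hc]
    refine card_le_of_forall_color_card_le (col := col) _ (fun x hx => ?_) fun i hi => ?_
    · simp [hJ, (hU x hx).2, ht x (hU x hx).1]
    · exact (Finset.card_le_card (Finset.filter_subset_filter _ (Finset.filter_subset _ _))).trans
        (hmax i (Finset.mem_of_mem_erase hi))
  have h4 := h2.trans h3
  rw [hk] at h4 hlt
  simp only [Nat.sub_zero] at h4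
  nlinarith

/-- A convex chain of a fan enumerating a color class is short. -/
theorem convex_chain_length_le {e n a b : ℕ} {col : Plane → Fin (e + 2)}
    (hgen : GeneralPosition S) (hS : TrianglesContain S col (e + 1)) {p : Plane} {q : ℕ → Plane}
    (hq : IsFan p q n) (hp : p ∈ S) (hqS : ∀ i < n, q i ∈ S) (hqc : ∀ i < n, col (q i) = col p)
    (hall : ∀ x ∈ S, col x = col p → x = p ∨ ∃ i < n, x = q i) (hab : a < b) (hb : b < n)
    (hconv : ∀ i, a ≤ i → i + 2 ≤ b → 0 < orient (q i) (q (i + 1)) (q (i + 2))) :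
    b - a ≤ 2 * (e + 1) := by
  -- The points of `S` interior to the convex polygon with vertices `p`, `q a`, …, `q b`, written as
  -- an intersection of half-planes.
  set X := S.filter fun x => 0 < orient p (q a) x ∧ 0 < orient p x (q b) ∧
    ∀ l, a ≤ l → l + 1 ≤ b → 0 < orient (q l) (q (l + 1)) x with hX
  have h1 : (b - a) * (e + 1) ≤ X.card := by
    refine (fan_card hS hq hb hp hqS hqc).trans (Finset.card_le_card fun x hx => ?_)
    obtain ⟨hxS, i, hai, hib, hxi⟩ := Finset.mem_filter.1 hx
    obtain ⟨h2, h3⟩ := IsFan.sector_of_inTri hxi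
    refine Finset.mem_filter.2 ⟨hxS, hq.left_of_sector (by omega) hai (by omega) h2 h3,
      hq.right_of_sector (by omega) hib hb h2 h3, fun l hal hlb => ?_⟩
    have h4 : 0 < orient (q l) (q (l + 1)) p := by
      rw [orient_rotate]; exact hq l (l + 1) (by omega) (by omega)
    exact hxi.pos_of_nonneg h4.le (hq.chain_nonneg hb hconv hal hlb hai hib.le)
      (hq.chain_nonneg hb hconv hal hlb (by omega) (by omega)) (Or.inl h4)
  have h2 : ∀ x ∈ X, col x ≠ col p := by
    intro x hx hxp
    obtain ⟨hxS, hx1, hx2, hx3⟩ := Finset.mem_filter.1 hx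
    rcases hall x hxS hxp with rfl | ⟨i, hi, rfl⟩
    · simp at hx1
    · obtain ⟨h3, h4⟩ := hq.index_of_sector (by omega) hi hx1 hx2
      have := hx3 i h3.le h4
      simp at this
  -- By convexity, a triangle with vertices in `X` has the same interior points in `X` as in `S`.
  have h3 : TrianglesContain X col (e + 1) := by
    intro u hu v hv w hw huv huw ho
    obtain ⟨huS, hu1, hu2, hu3⟩ := Finset.mem_filter.1 hu
    obtain ⟨hvS, hv1, hv2, hv3⟩ := Finset.mem_filter.1 hv
    obtain ⟨hwS, hw1, hw2, hw3⟩ := Finset.mem_filter.1 hw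
    refine (hS u huS v hvS w hwS huv huw ho).trans (Finset.card_le_card fun x hx => ?_)
    obtain ⟨hxS, hx⟩ := Finset.mem_filter.1 hx
    refine Finset.mem_filter.2 ⟨Finset.mem_filter.2 ⟨hxS, ?_, ?_, ?_⟩, hx⟩
    · exact hx.pos_of_nonneg hu1.le hv1.le hw1.le (Or.inl hu1)
    · rw [orient_rotate] at hu2 hv2 hw2 ⊢
      exact hx.pos_of_nonneg hu2.le hv2.le hw2.le (Or.inl hu2)
    · exact fun l hal hlb => hx.pos_of_nonneg (hu3 l hal hlb).le (hv3 l hal hlb).le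
        (hw3 l hal hlb).le (Or.inl (hu3 l hal hlb))
  have h4 := card_le_of_missing_color (hgen.mono (Finset.filter_subset _ S)) h3 h2
  refine Nat.le_of_mul_le_mul_right (h1.trans (h4.trans_eq (mul_comm _ _))) (by omega)

theorem card_lt_of_trianglesContain {e : ℕ} {col : Plane → Fin (e + 2)}
    (hgen : GeneralPosition S) (hS : TrianglesContain S col (e + 1)) :
    S.card < (e + 2) * (3 * (2 * e + 3) + 2) := by
  by_contra! hbig
  -- One more than the longest possible convex chain, so every window of `B` steps has a reflex
  -- vertex. A class of 3B + 2 points has room for three consecutive windows besides the apex.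
  set B := 2 * e + 3 with hB
  obtain ⟨t, -, hmax⟩ := (Finset.univ : Finset (Fin (e + 2))).exists_max_image
    (fun i => (S.filter fun x => col x = i).card) Finset.univ_nonempty
  set m := (S.filter fun x => col x = t).card with hm
  have h1 : S.card ≤ (e + 2) * m := by
    simpa using card_le_of_forall_color_card_le Finset.univ (fun x _ => Finset.mem_univ _) hmax
  have h2 : 3 * B + 2 ≤ m := Nat.le_of_mul_le_mul_left (hbig.trans h1) (by omega)
  obtain ⟨n, hn⟩ : ∃ n, m = n + 1 := ⟨m - 1, by omega⟩
  obtain ⟨p, hp, rfl, q, hqS, hqc, hq, hall⟩ := exists_fan_of_color hgen (hm.symm.trans hn)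
  have qinj : ∀ i j, i < j → j < n → q i ≠ q j := by
    intro i j hij hj h
    have := hq i j hij hj
    simp [h] at this
  have reflex : ∀ a, a + B < n →
      ∃ i, a ≤ i ∧ i + 2 ≤ a + B ∧ orient (q i) (q (i + 1)) (q (i + 2)) < 0 := by
    intro a ha
    by_contra! hc
    have := convex_chain_length_le hgen hS hq hp hqS hqc hall (by omega : a < a + B) ha
      fun i hai hib => (hc i hai hib).lt_of_ne' fun h0 =>
        hgen _ (hqS i (by omega)) _ (hqS (i + 1) (by omega)) _ (hqS (i + 2) (by omega))
          (qinj _ _ (by omega) (by omega)) (qinj _ _ (by omega) (by omega))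
          (qinj _ _ (by omega) (by omega))
          ((collinear_iff_orient (qinj _ _ (by omega) (by omega))).2 h0)
    omega
  set R : ℕ → Finset Plane := fun i => S.filter (InTri (q i) (q (i + 2)) (q (i + 1))) with hR
  set U := S.filter fun x => ∃ i, 0 ≤ i ∧ i < n - 1 ∧ InTri p (q i) (q (i + 1)) x with hU
  have hUcard := fan_card (a := 0) (b := n - 1) hS hq (by omega) hp hqS hqc
  rw [← hU] at hUcard
  have hRcard : ∀ i, i + 2 < n → orient (q i) (q (i + 1)) (q (i + 2)) < 0 →
      e + 1 ≤ (R i).card := by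
    intro i hi ho
    refine hS _ (hqS i (by omega)) _ (hqS (i + 2) hi) _ (hqS (i + 1) (by omega)) ?_ ?_ ?_
    · rw [hqc _ hi, hqc _ (by omega)]
    · rw [hqc _ (by omega), hqc _ (by omega)]
    · rw [orient_swap_right]; linarith
  -- Reflex triangles whose indices differ by at least two lie in non-overlapping sectors at `p`.
  have hRR : ∀ i j, i + 2 ≤ j → j + 2 < n → Disjoint (R i) (R j) := by
    intro i j hij hj
    rw [Finset.disjoint_left]
    intro x hx hx'
    obtain ⟨h3, h4⟩ := hq.sector_of_inTri_reflex (by omega) (Finset.mem_filter.1 hx).2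
    obtain ⟨h5, -⟩ := hq.sector_of_inTri_reflex hj (Finset.mem_filter.1 hx').2
    exact hq.not_mem_both (by omega) hij (by omega : j < j + 1) (by omega) h3 h4 h5
  have hUR : ∀ i, i + 2 < n → Disjoint U (R i) := by
    intro i hi
    rw [Finset.disjoint_left]
    intro x hx hx'
    obtain ⟨-, j, -, hj, hxj⟩ := Finset.mem_filter.1 hx
    have hxi := (Finset.mem_filter.1 hx').2
    obtain ⟨h3, h4⟩ := IsFan.sector_of_inTri hxj
    obtain ⟨h5, h6⟩ := hq.sector_of_inTri_reflex hi hxi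
    -- Only the two fan triangles at the reflex vertex share its sector; each is separated from the
    -- reflex triangle by their common edge.
    rcases (by omega : j + 1 ≤ i ∨ j = i ∨ j = i + 1 ∨ i + 2 ≤ j) with h | rfl | rfl | h
    · exact hq.not_mem_both (by omega) h (by omega : i < i + 1) (by omega) h3 h4 h5
    · have := hxi.2.2
      rw [orient_swap] at this
      linarith [hxj.2.1]
    · have := hxi.2.1
      rw [orient_swap] at this
      linarith [hxj.2.1]
    · exact hq.not_mem_both (by omega) h (by omega : j < j + 1) (by omega) h5 h6 h3
  have hUcol : ∀ x ∈ U, col x ≠ col p := by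
    intro x hx hxp
    obtain ⟨hxS, i, -, hi, hxi⟩ := Finset.mem_filter.1 hx
    exact ne_of_inTri_fan hq (by omega) hxi (hall x hxS hxp)
  have hRcol : ∀ i, i + 2 < n → ∀ x ∈ R i, col x ≠ col p := by
    intro i hi x hx hxp
    obtain ⟨hxS, hxi⟩ := Finset.mem_filter.1 hx
    obtain ⟨h3, h4⟩ := hq.sector_of_inTri_reflex hi hxi
    rcases hall x hxS hxp with rfl | ⟨j, hj, rfl⟩
    · simp at h3
    · have := hq.index_of_sector (by omega) hj h3 h4
      obtain rfl : j = i + 1 := by omega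
      simp [InTri] at hxi
  obtain ⟨i₀, -, hi₀, ho₀⟩ := reflex 0 (by omega)
  obtain ⟨i₁, hi₁, hi₁', ho₁⟩ := reflex B (by omega)
  obtain ⟨i₂, hi₂, hi₂', ho₂⟩ := reflex (B + B) (by omega)
  have h3 : (U ∪ (R i₀ ∪ (R i₁ ∪ R i₂))).card ≤ (e + 1) * m := by
    have hc : (Finset.univ.erase (col p)).card = e + 1 := by simp
    rw [← hc]
    refine card_le_of_forall_color_card_le (col := col) _ (fun x hx => ?_) fun i _ => ?_
    · rw [Finset.mem_erase]
      refine ⟨?_, Finset.mem_univ _⟩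
      simp only [Finset.mem_union] at hx
      rcases hx with h | h | h | h
      · exact hUcol x h
      · exact hRcol i₀ (by omega) x h
      · exact hRcol i₁ (by omega) x h
      · exact hRcol i₂ (by omega) x h
    · refine (Finset.card_le_card (Finset.filter_subset_filter _ ?_)).trans
        (hmax i (Finset.mem_univ _))
      simp only [Finset.union_subset_iff]
      exact ⟨Finset.filter_subset _ _, Finset.filter_subset _ _, Finset.filter_subset _ _,
        Finset.filter_subset _ _⟩
  -- Disjointness gives (n - 1)(e + 1) + 3(e + 1) ≤ (e + 1)(n + 1), which is false; two reflex
  -- triangles would only give equality.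
  rw [Finset.card_union_of_disjoint, Finset.card_union_of_disjoint,
    Finset.card_union_of_disjoint (hRR i₁ i₂ (by omega) (by omega))] at h3
  · have c0 := hRcard i₀ (by omega) ho₀
    have c1 := hRcard i₁ (by omega) ho₁
    have c2 := hRcard i₂ (by omega) ho₂
    obtain ⟨k, rfl⟩ : ∃ k, n = k + 1 := ⟨n - 1, by omega⟩
    rw [hn] at h3
    simp only [Nat.sub_zero, Nat.add_sub_cancel] at hUcard
    nlinarith
  · rw [Finset.disjoint_union_right]
    exact ⟨hRR i₀ i₁ (by omega) (by omega), hRR i₀ i₂ (by omega) (by omega)⟩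
  · simp only [Finset.disjoint_union_right]
    exact ⟨hUR i₀ (by omega), hUR i₁ (by omega), hUR i₂ (by omega)⟩

theorem forces_triangle (e : ℕ) : Forces 3 (e + 2) e ((e + 2) * (3 * (2 * e + 3) + 2)) := by
  intro S hgen hcard col _
  by_contra hno
  refine (card_lt_of_trianglesContain hgen (col := col) ?_).not_ge hcard
  intro a ha b hb d hd hba hda ho
  by_contra! hlt
  refine hno ⟨{a, b, d}, ?_, ?_, ?_, ⟨col a, ?_⟩, ?_⟩
  · simp [Finset.insert_subset_iff, ha, hb, hd]
  · refine Finset.card_eq_three.2 ⟨a, b, d, ?_, ?_, ?_, rfl⟩ <;> rintro rfl <;> simp at ho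
  · have := convexIndependent_of_orient_ne_zero ho.ne'
    rwa [← Finset.coe_pair, ← Finset.coe_insert] at this
  · simp [hba, hda]
  · rw [interiorCount_triple S ho]; omega

end Count

/-! ### Conclusion -/

theorem M_lt_top_iff {r c s : ℕ} : M r c s < ⊤ ↔ ∃ N, Forces r c s N := by
  rw [M, sInf_lt_iff]
  constructor
  · rintro ⟨_, ⟨N, -, hN⟩, -⟩
    exact ⟨N, hN⟩
  · rintro ⟨N, hN⟩
    exact ⟨N, ⟨N, rfl, hN⟩, ENat.natCast_lt_top N⟩

theorem theorem2 (c : ℕ) (hc : 2 ≤ c) :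
    IsLeast {s : ℕ | M 3 c s < ⊤} (lambda3 c) ∧
      (c - 1) / 2 ≤ lambda3 c ∧ lambda3 c ≤ c - 2 := by
  have hmem : c - 2 ∈ {s : ℕ | M 3 c s < ⊤} := by
    obtain ⟨e, rfl⟩ := Nat.exists_eq_add_of_le' hc
    exact M_lt_top_iff.2 ⟨_, forces_triangle e⟩
  have hleast : IsLeast {s : ℕ | M 3 c s < ⊤} (lambda3 c) :=
    -- Nonemptiness matters: otherwise the infimum defining `lambda3` would be the default value 0.
    ⟨Nat.sInf_mem ⟨_, hmem⟩, fun s hs => Nat.sInf_le hs⟩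
  refine ⟨hleast, ?_, hleast.2 hmem⟩
  by_contra! hlt
  obtain ⟨N, hN⟩ := M_lt_top_iff.1 hleast.1
  exact not_forces_triangle hlt N hN
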